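/- Let $d\ge 0$ and $n\ge d+1$ be integers, and let $(\xi_1,\dots,\xi_n)$ be an exchangeable tuple of random vectors in $\mathbb{R}^d$, i.e. $(\xi_{\sigma(1)},\dots,\xi_{\sigma(n)})$ has the same joint distribution as $(\xi_1,\dots,\xi_n)$ for every permutation $\sigma$ of $\{1,\dots,n\}$. Put $S_k=\xi_1+\dots+\xi_k$ for $1\le k\le n$. Assume that $S_n=0$ almost surely and that any $d$ of the random vectors $S_1,\dots,S_{n-1}$ (that is, $S_{i_1},\dots,S_{i_d}$ for any $1\le i_1<\dots<i_d\le n-1$) are linearly independent almost surely. Then $$\mathbb{P}\bigl[0\in \operatorname{Conv}(S_1,\dots,S_{n-1})\bigr]=\frac{2}{n!}\left(\genfrac{[}{]}{0pt}{}{n}{d+2}+\genfrac{[}{]}{0pt}{}{n}{d+4}+\cdots\right),$$ where $\operatorname{Conv}$ denotes the convex hull and $\genfrac{[}{]}{0pt}{}{n}{k}$ are the (unsigned) Stirling numbers of the first kind, defined by $t(t+1)\cdots(t+n-1)=\sum_{k=1}^{n}\genfrac{[}{]}{0pt}{}{n}{k}t^k$ and $\genfrac{[}{]}{0pt}{}{n}{k}=0$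 for $k\notin\{1,\dots,n\}$; in particular the sum has only finitely many nonzero terms. -/

import Mathlib

open MeasureTheory ProbabilityTheory

/-- A tuple `(ξ 0, …, ξ (n - 1))` of random elements is exchangeable if its joint distribution
is invariant under every permutation of the indices. -/
def Exchangeable {Ω E : Type*} [MeasurableSpace Ω] [MeasurableSpace E] {n : ℕ}
    (ξ : Fin n → Ω → E) (P : Measure Ω) : Prop :=
  ∀ σ : Equiv.Perm (Fin n), IdentDistrib (fun ω i => ξ i ω) (fun ω i => ξ (σ i) ω) P P

/-- The partial sum `S k` of the first `k` increments (for `k ≤ n`); the increments are indexed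
from `0`, so that in the usual indexing `S k = ξ₁ + ⋯ + ξₖ`. -/
def partialSum {Ω E : Type*} [AddCommMonoid E] {n : ℕ} (ξ : Fin n → Ω → E) (k : ℕ) (ω : Ω) : E :=
  ∑ i ∈ Finset.univ.filter (fun i : Fin n => i.val < k), ξ i ω

/-- Mathlib's `Nat.stirlingFirst n k` are the coefficients of `t (t + 1) ⋯ (t + n - 1)`
(the unsigned Stirling numbers of the first kind). -/
theorem prod_eq_sum_stirlingFirst (n : ℕ) :
    ∏ i ∈ Finset.range n, (Polynomial.X + Polynomial.C (i : ℤ)) =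
      ∑ k ∈ Finset.range (n + 1),
        Polynomial.C (Nat.stirlingFirst n k : ℤ) * Polynomial.X ^ k := by
  ext k
  simp only [Polynomial.finsetSum_coeff, Polynomial.coeff_C_mul_X_pow]
  rw [Finset.sum_ite_eq]
  have key : ∀ (n k : ℕ), (∏ i ∈ Finset.range n,
      (Polynomial.X + Polynomial.C (i : ℤ))).coeff k = (Nat.stirlingFirst n k : ℤ) := by
    intro n
    induction n with
    | zero => intro k; cases k <;> simp [Polynomial.coeff_one, Nat.stirlingFirst]
    | succ n ih =>
      intro k
      rw [Finset.prod_range_succ, mul_add, Polynomial.coeff_add, Polynomial.coeff_mul_C, ih]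
      cases k with
      | zero => cases n <;> simp [Nat.stirlingFirst]
      | succ k =>
        rw [Polynomial.coeff_mul_X, ih, Nat.stirlingFirst]
        push_cast
        ring
  rw [key]
  split_ifs with h
  · rfl
  · rw [Nat.stirlingFirst_eq_zero_of_lt (by simpa using h)]
    rfl

/-! By exchangeability the probability is an average over all orderings, so it is enough that, for
almost every ω, a fixed number of orderings of x = ξ(ω) have 0 in the hull of their proper partial
sums. As the x i sum to zero, summation by parts turns positive relations among partial sums into
relations among the x i with strictly increasing coefficients. In general position a nonzero
nonnegative relation can be made positive, so hull membership is `HasMonoRelation`.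

The number N(n, d) of such orderings is found by deleting v = x 0. Fix the order of the other
vectors. By convexity the admissible positions of v form an interval, and two adjacent positions are
both admissible exactly when a relation survives adding v to the vector between them. Hence
positions = merges + 1, unless there are none; some position exists exactly when there is a relation
modulo v (`card_insertNth_eq`). Merging and projecting preserve general position and zero sum, so
N(n+1, d+1) = n N(n, d+1) + N(n, d), the recurrence of the Stirling sums. The boundary values are
N(n, 0) = n! for n ≥ 2 and N(d+1, d) = 0 for d ≥ 1. -/

/-! ### Inserting one vector into an ordering, and the resulting recurrence. -/

section Insertion

variable {V : Type*} [AddCommGroup V] [Module ℝ V]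

/-- The vectors `y 0, …, y (n - 1)` satisfy a linear relation with strictly increasing
coefficients. -/
def HasMonoRelation {n : ℕ} (y : Fin n → V) : Prop :=
  ∃ a : Fin n → ℝ, StrictMono a ∧ ∑ i, a i • y i = 0

theorem hasMonoRelation_insertNth_iff {n : ℕ} (p : Fin (n + 1)) (v : V) (z : Fin n → V) :
    HasMonoRelation (p.insertNth v z : Fin (n + 1) → V) ↔
      ∃ (a : Fin n → ℝ) (c : ℝ), StrictMono a ∧ (∀ i, i.castSucc < p → a i < c) ∧
        (∀ i, p ≤ i.castSucc → c < a i) ∧ c • v + ∑ i, a i • z i = 0 := by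
  constructor
  · rintro ⟨b, hb, hsum⟩
    rw [← Fin.insertNth_self_removeNth p b, Fin.strictMono_insertNth_iff] at hb
    rw [Fin.sum_univ_succAbove _ p] at hsum
    simp only [Fin.insertNth_apply_same, Fin.insertNth_apply_succAbove] at hsum
    exact ⟨p.removeNth b, b p, hb.1, hb.2.1, hb.2.2, hsum⟩
  · rintro ⟨a, c, ha, hlt, hgt, hsum⟩
    refine ⟨p.insertNth c a, (Fin.strictMono_insertNth_iff p c a).2 ⟨ha, hlt, hgt⟩, ?_⟩
    rw [Fin.sum_univ_succAbove _ p]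
    simpa using hsum

/-- This is the wall on which `v` and `z i` share a coefficient. -/
theorem hasMonoRelation_update_iff {n : ℕ} (i : Fin n) (v : V) (z : Fin n → V) :
    HasMonoRelation (Function.update z i (z i + v)) ↔
      ∃ a : Fin n → ℝ, StrictMono a ∧ a i • v + ∑ k, a k • z k = 0 := by
  have key : ∀ a : Fin n → ℝ, ∑ k, a k • Function.update z i (z i + v) k =
      a i • v + ∑ k, a k • z k := by
    intro a
    have : Function.update z i (z i + v) = z + Pi.single i v := by
      ext k
      by_cases h : k = i
      · subst h; simp
      · simp [h]
    rw [this]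
    simp only [Pi.add_apply, smul_add, Finset.sum_add_distrib]
    rw [add_comm, Finset.sum_eq_single i (fun k _ hk => by simp [hk]) (by simp)]
    simp
  simp only [HasMonoRelation, key]

/-- Working modulo `v` leaves the coefficient of `v` unconstrained. -/
theorem hasMonoRelation_mkQ_iff {n : ℕ} (v : V) (z : Fin n → V) :
    HasMonoRelation (fun i => (Submodule.span ℝ {v}).mkQ (z i)) ↔
      ∃ (a : Fin n → ℝ) (c : ℝ), StrictMono a ∧ c • v + ∑ i, a i • z i = 0 := by
  refine exists_congr fun a => ?_
  rw [exists_and_left]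
  refine and_congr_right fun _ => ?_
  simp only [← map_smul, ← map_sum]
  rw [Submodule.mkQ_apply, Submodule.Quotient.mk_eq_zero, Submodule.mem_span_singleton]
  constructor
  · rintro ⟨c, hc⟩
    exact ⟨-c, by rw [← hc]; simp⟩
  · rintro ⟨c, hc⟩
    exact ⟨-c, by rw [neg_smul, neg_eq_iff_add_eq_zero, hc]⟩

/-- A relation in which the coefficient of `v` equals the `i`-th coefficient lies on a wall, and
can be perturbed to either side of it. -/
theorem hasMonoRelation_insertNth_of_update {n : ℕ} {i : Fin n} {v : V} {z : Fin n → V}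
    (hspan : ∃ b : Fin n → ℝ, b i = 0 ∧ ∑ k, b k • z k = v)
    (h : HasMonoRelation (Function.update z i (z i + v))) :
    HasMonoRelation (i.castSucc.insertNth v z : Fin (n + 1) → V) ∧
      HasMonoRelation (i.succ.insertNth v z : Fin (n + 1) → V) := by
  obtain ⟨a, ha, hsum⟩ := (hasMonoRelation_update_iff i v z).1 h
  obtain ⟨b, hbi, hb⟩ := hspan
  -- Trade `ε • v` for its expression in `z`. As `b i = 0`, the coefficient of `z i` stays put while
  -- that of `v` leaves the wall, below it for ε > 0 and above it for ε < 0.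
  have hev : ∀ᶠ ε in nhds (0 : ℝ), (∀ j k : Fin n, j < k → a j + ε * b j < a k + ε * b k) ∧
      (∀ k, k < i → a k + ε * b k < a i - ε) ∧ (∀ k, i < k → a i - ε < a k + ε * b k) := by
    refine Filter.Eventually.and ?_ (Filter.Eventually.and ?_ ?_)
    · refine Filter.eventually_all.2 fun j => Filter.eventually_all.2 fun k => ?_
      by_cases hjk : j < k
      · have : ContinuousAt (fun ε => a j + ε * b j) 0 := by fun_prop
        filter_upwards [this.eventually_lt (g := fun ε => a k + ε * b k) (by fun_prop)
          (by simpa using ha hjk)] with ε hε _ using hε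
      · simp [hjk]
    · refine Filter.eventually_all.2 fun k => ?_
      by_cases hk : k < i
      · have : ContinuousAt (fun ε => a k + ε * b k) 0 := by fun_prop
        filter_upwards [this.eventually_lt (g := fun ε => a i - ε) (by fun_prop)
          (by simpa using ha hk)] with ε hε _ using hε
      · simp [hk]
    · refine Filter.eventually_all.2 fun k => ?_
      by_cases hk : i < k
      · have : ContinuousAt (fun ε => a i - ε) 0 := by fun_prop
        filter_upwards [this.eventually_lt (g := fun ε => a k + ε * b k) (by fun_prop)
          (by simpa using ha hk)] with ε hε _ using hε
      · simp [hk]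
  have hrel : ∀ ε : ℝ, (a i - ε) • v + ∑ k, (a k + ε * b k) • z k = 0 := by
    intro ε
    simp only [add_smul, mul_smul, Finset.sum_add_distrib, ← Finset.smul_sum, hb, sub_smul]
    rw [← hsum]
    abel
  constructor
  · obtain ⟨ε, ⟨h1, h2, h3⟩, hε⟩ := ((hev.filter_mono nhdsWithin_le_nhds).and
      (self_mem_nhdsWithin (s := Set.Ioi (0 : ℝ)))).exists
    replace hε : 0 < ε := hε
    refine (hasMonoRelation_insertNth_iff _ _ _).2
      ⟨fun k => a k + ε * b k, a i - ε, fun j k hjk => h1 j k hjk, fun k hk => h2 k (by simpa using hk),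
        fun k hk => ?_, hrel ε⟩
    rcases (show i ≤ k by simpa using hk).eq_or_lt with rfl | hk
    · simp [hbi, hε]
    · exact h3 k hk
  · obtain ⟨ε, ⟨h1, h2, h3⟩, hε⟩ := ((hev.filter_mono nhdsWithin_le_nhds).and
      (self_mem_nhdsWithin (s := Set.Iio (0 : ℝ)))).exists
    replace hε : ε < 0 := hε
    refine (hasMonoRelation_insertNth_iff _ _ _).2
      ⟨fun k => a k + ε * b k, a i - ε, fun j k hjk => h1 j k hjk, fun k hk => ?_,
        fun k hk => h3 k (Fin.succ_le_castSucc_iff.1 hk), hrel ε⟩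
    rcases (Fin.castSucc_lt_succ_iff.1 hk).eq_or_lt
      with rfl | hk
    · simp only [hbi]; linarith
    · exact h2 k hk

/-- The coefficient of `v` is below that of `z i` in one relation and above it in the other; a
positive combination, which is again increasing, equalizes them. -/
theorem hasMonoRelation_update_of_insertNth {n : ℕ} {p q : Fin (n + 1)} {v : V} {z : Fin n → V}
    (hp : HasMonoRelation (p.insertNth v z : Fin (n + 1) → V))
    (hq : HasMonoRelation (q.insertNth v z : Fin (n + 1) → V)) {i : Fin n}
    (hpi : p ≤ i.castSucc) (hiq : i.castSucc < q) :
    HasMonoRelation (Function.update z i (z i + v)) := by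
  obtain ⟨a, c, ha, -, hgt, hs⟩ := (hasMonoRelation_insertNth_iff _ _ _).1 hp
  obtain ⟨a', c', ha', hlt, -, hs'⟩ := (hasMonoRelation_insertNth_iff _ _ _).1 hq
  have hu := hgt i hpi
  have hv := hlt i hiq
  refine (hasMonoRelation_update_iff _ _ _).2
    ⟨fun k => (c' - a' i) * a k + (a i - c) * a' k, fun j k hjk => ?_, ?_⟩
  · have h1 := mul_lt_mul_of_pos_left (ha hjk) (sub_pos.2 hv)
    have h2 := mul_lt_mul_of_pos_left (ha' hjk) (sub_pos.2 hu)
    exact add_lt_add h1 h2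
  · have : (c' - a' i) * a i + (a i - c) * a' i = (c' - a' i) * c + (a i - c) * c' := by ring
    simp only [this]
    calc _ = (c' - a' i) • (c • v + ∑ k, a k • z k) +
          (a i - c) • (c' • v + ∑ k, a' k • z k) := by
          simp only [add_smul, mul_smul, Finset.sum_add_distrib, ← Finset.smul_sum, smul_add]
          abel
      _ = 0 := by rw [hs, hs']; simp

/-- The coefficient of `v` either falls in a gap of the increasing sequence, which gives the
position, or hits an entry, and is then pushed off that wall. -/
theorem exists_hasMonoRelation_insertNth {n : ℕ} {v : V} {z : Fin n → V}
    (hspan : ∀ i, ∃ b : Fin n → ℝ, b i = 0 ∧ ∑ k, b k • z k = v)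
    (h : HasMonoRelation fun i => (Submodule.span ℝ {v}).mkQ (z i)) :
    ∃ p : Fin (n + 1), HasMonoRelation (p.insertNth v z : Fin (n + 1) → V) := by
  obtain ⟨a, c, ha, hs⟩ := (hasMonoRelation_mkQ_iff _ _).1 h
  by_cases hall : ∀ k, a k < c
  · refine ⟨Fin.last n, (hasMonoRelation_insertNth_iff _ _ _).2
      ⟨a, c, ha, fun i _ => hall i, fun i hi => ?_, hs⟩⟩
    exact absurd hi (not_le.2 (Fin.castSucc_lt_last i))
  · push Not at hall
    obtain ⟨i, hi, hmin⟩ := wellFounded_lt.has_min {k | c ≤ a k} hall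
    have hbelow : ∀ k, k < i → a k < c := fun k hk => by
      by_contra hc
      exact hmin k (not_lt.1 hc) hk
    rcases (show c ≤ a i from hi).eq_or_lt with rfl | hlt
    · exact ⟨_, (hasMonoRelation_insertNth_of_update (hspan i)
        ((hasMonoRelation_update_iff _ _ _).2 ⟨a, ha, hs⟩)).1⟩
    · refine ⟨i.castSucc, (hasMonoRelation_insertNth_iff _ _ _).2
        ⟨a, c, ha, fun k hk => hbelow k (by simpa using hk), fun k hk => ?_, hs⟩⟩
      exact hlt.trans_le (ha.monotone (by simpa using hk))

open Classical in
/-- The number of places where `v` can be inserted into `z` exceeds by one the number of entries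
of `z` to which it can be added, unless both vanish. -/
theorem card_insertNth_eq {n : ℕ} {v : V} {z : Fin n → V}
    (hspan : ∀ i, ∃ b : Fin n → ℝ, b i = 0 ∧ ∑ k, b k • z k = v) :
    (Finset.univ.filter fun p : Fin (n + 1) =>
        HasMonoRelation (p.insertNth v z : Fin (n + 1) → V)).card =
      (Finset.univ.filter fun i : Fin n =>
        HasMonoRelation (Function.update z i (z i + v))).card +
      if HasMonoRelation (fun i => (Submodule.span ℝ {v}).mkQ (z i)) then 1 else 0 := by
  set A := Finset.univ.filter fun p : Fin (n + 1) =>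
    HasMonoRelation (p.insertNth v z : Fin (n + 1) → V) with hA
  set W := Finset.univ.filter fun i : Fin n =>
    HasMonoRelation (Function.update z i (z i + v)) with hW
  have hWA : ∀ i ∈ W, i.castSucc ∈ A ∧ i.succ ∈ A := fun i hi => by
    simpa [hA] using hasMonoRelation_insertNth_of_update (hspan i) (Finset.mem_filter.1 hi).2
  have hAq : A.Nonempty ↔ HasMonoRelation (fun i => (Submodule.span ℝ {v}).mkQ (z i)) := by
    constructor
    · rintro ⟨p, hp⟩
      obtain ⟨a, c, ha, -, -, hs⟩ :=
        (hasMonoRelation_insertNth_iff _ _ _).1 (Finset.mem_filter.1 hp).2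
      exact (hasMonoRelation_mkQ_iff _ _).2 ⟨a, c, ha, hs⟩
    · intro h
      obtain ⟨p, hp⟩ := exists_hasMonoRelation_insertNth hspan h
      exact ⟨p, by simp [hA, hp]⟩
  rw [← if_congr hAq rfl rfl]
  split_ifs with hne
  · have himage : A.erase (A.min' hne) = W.map (Fin.succEmb n) := by
      ext p
      simp only [Finset.mem_erase, Finset.mem_map, Fin.coe_succEmb]
      constructor
      · rintro ⟨hp0, hp⟩
        have hlt : A.min' hne < p := lt_of_le_of_ne (A.min'_le _ hp) (Ne.symm hp0)
        obtain ⟨i, rfl⟩ := Fin.exists_succ_eq.2 (Fin.ne_zero_of_lt hlt)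
        refine ⟨i, ?_, rfl⟩
        simp only [hW, Finset.mem_filter, Finset.mem_univ, true_and]
        exact hasMonoRelation_update_of_insertNth
          (Finset.mem_filter.1 (A.min'_mem hne)).2 (Finset.mem_filter.1 hp).2
          (Fin.le_castSucc_iff.2 hlt) (Fin.castSucc_lt_succ)
      · rintro ⟨i, hi, rfl⟩
        obtain ⟨h1, h2⟩ := hWA i hi
        exact ⟨((A.min'_le _ h1).trans_lt Fin.castSucc_lt_succ).ne', h2⟩
    rw [← Finset.card_erase_add_one (A.min'_mem hne), himage, Finset.card_map]
  · rw [Finset.not_nonempty_iff_eq_empty] at hne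
    have : W = ∅ := Finset.eq_empty_of_forall_notMem fun i hi => by
      simpa [hne] using (hWA i hi).1
    rw [hne, this]
    simp

/-- The number of orderings of `x` with a strictly increasing relation. -/
noncomputable def monoRelationCount {n : ℕ} (x : Fin n → V) : ℕ :=
  Nat.card {σ : Equiv.Perm (Fin n) // HasMonoRelation (x ∘ σ)}

/-- A permutation of `Fin (n + 1)` given by the position of `0` and by the order of the rest. -/
def insertZeroPerm {n : ℕ} (q : Fin (n + 1) × Equiv.Perm (Fin n)) : Equiv.Perm (Fin (n + 1)) :=
  (finSuccEquiv' q.1).trans (q.2.optionCongr.trans (finSuccEquiv' 0).symm)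

theorem comp_insertZeroPerm {α : Type*} {n : ℕ} (x : Fin (n + 1) → α)
    (q : Fin (n + 1) × Equiv.Perm (Fin n)) :
    x ∘ insertZeroPerm q = (q.1.insertNth (x 0) (Fin.tail x ∘ q.2) : Fin (n + 1) → α) := by
  ext k
  cases k using Fin.succAboveCases q.1 <;> simp [insertZeroPerm, Fin.tail]

theorem insertZeroPerm_bijective (n : ℕ) : Function.Bijective (insertZeroPerm (n := n)) := by
  rw [Fintype.bijective_iff_injective_and_card]
  refine ⟨fun q q' h => ?_, by simp [Fintype.card_perm, Nat.factorial_succ]⟩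
  have h1 : q.1 = q'.1 := by
    have h0 : insertZeroPerm q q.1 = insertZeroPerm q' q'.1 := by simp [insertZeroPerm]
    rw [h] at h0
    exact (insertZeroPerm q').injective h0
  refine Prod.ext h1 (Equiv.ext fun k => ?_)
  have h2 := DFunLike.congr_fun h (q.1.succAbove k)
  nth_rewrite 2 [h1] at h2
  simpa [insertZeroPerm] using h2

/-- Sum `card_insertNth_eq` over all orders τ of the tail. -/
theorem monoRelationCount_succ {n : ℕ} (x : Fin (n + 1) → V)
    (hspan : ∀ j : Fin n, ∃ b : Fin n → ℝ, b j = 0 ∧ ∑ k, b k • Fin.tail x k = x 0) :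
    monoRelationCount x =
      (∑ j, monoRelationCount (Function.update (Fin.tail x) j (Fin.tail x j + x 0))) +
        monoRelationCount (fun i => (Submodule.span ℝ {x 0}).mkQ (Fin.tail x i)) := by
  classical
  have hspan' : ∀ (τ : Equiv.Perm (Fin n)) (i : Fin n),
      ∃ b : Fin n → ℝ, b i = 0 ∧ ∑ k, b k • (Fin.tail x ∘ τ) k = x 0 := by
    intro τ i
    obtain ⟨b, hb, hs⟩ := hspan (τ i)
    exact ⟨b ∘ τ, hb, by rw [← hs]; exact Equiv.sum_comp τ fun k => b k • Fin.tail x k⟩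
  simp only [monoRelationCount, Nat.card_eq_fintype_card, Fintype.card_subtype,
    Finset.card_filter]
  rw [← (insertZeroPerm_bijective n).sum_comp, Fintype.sum_prod_type, Finset.sum_comm]
  simp only [comp_insertZeroPerm]
  rw [Finset.sum_comm (s := Finset.univ) (t := Finset.univ) (γ := Fin n), ← Finset.sum_add_distrib]
  refine Finset.sum_congr rfl fun τ _ => ?_
  have := card_insertNth_eq (hspan' τ)
  simp only [Finset.card_filter] at this
  rw [this]
  refine congrArg₂ (· + ·) ?_ rfl
  refine Eq.trans ?_ (Equiv.sum_comp τ _)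
  refine Finset.sum_congr rfl fun i _ => ?_
  have : Function.update (Fin.tail x) (τ i) (Fin.tail x (τ i) + x 0) ∘ τ =
      Function.update (Fin.tail x ∘ τ) i ((Fin.tail x ∘ τ) i + x 0) := by
    rw [Function.update_comp_equiv]; simp
  rw [this]

end Insertion

/-! ### General position, stable under reordering, merging and projection. -/

section GeneralPosition

variable {V : Type*} [AddCommGroup V] [Module ℝ V]

/-- Along every strictly increasing chain of `d` proper nonempty index sets, the sums of the
vectors `x i` are linearly independent. -/
def ChainIndependent {n : ℕ} (d : ℕ) (x : Fin n → V) : Prop :=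
  ∀ A : Fin d → Finset (Fin n), StrictMono A → (∀ l, (A l).Nonempty ∧ A l ≠ Finset.univ) →
    LinearIndependent ℝ fun l => ∑ i ∈ A l, x i

theorem ChainIndependent.comp_perm {n d : ℕ} {x : Fin n → V} (h : ChainIndependent d x)
    (σ : Equiv.Perm (Fin n)) : ChainIndependent d (x ∘ σ) := by
  intro A hA hA'
  have := h (fun l => (A l).map σ.toEmbedding)
    (fun l m hlm => by simpa [Finset.map_ssubset_map] using hA hlm)
    (fun l => ⟨by simpa using (hA' l).1, fun hu => (hA' l).2 (by
      rwa [← Finset.map_univ_equiv σ, Finset.map_inj] at hu)⟩)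
  simpa using this

/-- Adding `x 0` to one of the other vectors preserves general position. -/
theorem ChainIndependent.merge {n d : ℕ} {x : Fin (n + 1) → V} (h : ChainIndependent d x)
    (j : Fin n) :
    ChainIndependent d (Function.update (Fin.tail x) j (Fin.tail x j + x 0)) := by
  intro A hA hA'
  -- Index 0 travels with `j`, so sums over `B S` are the merged sums over `S`.
  let B : Finset (Fin n) → Finset (Fin (n + 1)) := fun S =>
    if j ∈ S then Finset.cons 0 (S.map (Fin.succEmb n)) (by simp) else S.map (Fin.succEmb n)
  have hsucc : ∀ S (k : Fin n), k.succ ∈ B S ↔ k ∈ S := by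
    intro S k
    by_cases hj : j ∈ S <;> simp [B, hj]
  have hzero : ∀ S, (0 : Fin (n + 1)) ∈ B S ↔ j ∈ S := by
    intro S
    by_cases hj : j ∈ S <;> simp [B, hj]
  have hsum : ∀ S, ∑ i ∈ B S, x i =
      ∑ i ∈ S, Function.update (Fin.tail x) j (Fin.tail x j + x 0) i := by
    intro S
    have hu : Function.update (Fin.tail x) j (Fin.tail x j + x 0) =
        fun k => Fin.tail x k + if k = j then x 0 else 0 := by
      ext k
      by_cases hk : k = j
      · subst hk; simp
      · simp [hk]
    rw [hu, Finset.sum_add_distrib, Finset.sum_ite_eq']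
    by_cases hj : j ∈ S <;> simp [B, hj, Fin.tail, add_comm]
  have := h (fun l => B (A l)) (fun l m hlm => ?_) (fun l => ⟨?_, fun hu => (hA' l).2 ?_⟩)
  · simpa only [hsum] using this
  · have hlt := hA hlm
    rw [Finset.ssubset_iff_of_subset] at hlt ⊢
    · obtain ⟨k, hk, hk'⟩ := hlt
      exact ⟨k.succ, (hsucc _ _).2 hk, fun hc => hk' ((hsucc _ _).1 hc)⟩
    · intro k
      cases k using Fin.cases with
      | zero => rw [hzero, hzero]; exact fun hk => (hA hlm).le hk
      | succ k => rw [hsucc, hsucc]; exact fun hk => (hA hlm).le hk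
    · exact (hA hlm).le
  · obtain ⟨k, hk⟩ := (hA' l).1
    exact ⟨k.succ, (hsucc _ _).2 hk⟩
  · ext k
    rw [← hsucc, hu]
    simp

/-- Projecting along `x 0` preserves general position. -/
theorem ChainIndependent.quotient {n d : ℕ} {x : Fin (n + 1) → V}
    (h : ChainIndependent (d + 1) x) (hn : n ≠ 0) :
    ChainIndependent d fun i => (Submodule.span ℝ {x 0}).mkQ (Fin.tail x i) := by
  intro A hA hA'
  let B : Finset (Fin n) → Finset (Fin (n + 1)) := fun S =>
    Finset.cons 0 (S.map (Fin.succEmb n)) (by simp)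
  have hB : ∀ {S T}, S < T → B S < B T := fun {S T} hST =>
    ⟨Finset.cons_subset_cons.2 (Finset.map_subset_map.2 hST.1),
      fun hc => hST.2 (Finset.map_subset_map.1 (Finset.cons_subset_cons.1 hc))⟩
  -- Adding 0 to every set makes room for `{0}` at the bottom: a chain of length d + 1, with `{0}`
  -- proper because n ≠ 0.
  have := h (Fin.cons (B ∅) fun l => B (A l)) ?_ ?_
  · rw [Fintype.linearIndependent_iff] at this ⊢
    intro g hg
    simp only [← map_sum, ← map_smul] at hg
    rw [Submodule.mkQ_apply, Submodule.Quotient.mk_eq_zero, Submodule.mem_span_singleton] at hg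
    obtain ⟨c, hc⟩ := hg
    -- The sets other than `{0}` contribute `(c + ∑ l, g l) • x 0`; the first coefficient cancels
    -- it.
    have := this (Fin.cons (-c - ∑ l, g l) g) ?_
    · exact fun i => by simpa using this i.succ
    · rw [Fin.sum_univ_succ]
      simp only [Fin.cons_zero, Fin.cons_succ]
      simp only [B, Finset.sum_cons, Finset.sum_map, smul_add, Finset.sum_add_distrib,
        ← Finset.sum_smul]
      simp only [Fin.coe_succEmb, Finset.sum_empty, smul_zero, add_zero, sub_smul, neg_smul, hc]
      simp only [Fin.tail]
      abel
  · rw [Fin.strictMono_cons]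
    exact ⟨fun l => hB (Finset.bot_eq_empty ▸ bot_lt_iff_ne_bot.2
      (Finset.nonempty_iff_ne_empty.1 (hA' l).1)), fun l m hlm => hB (hA hlm)⟩
  · intro l
    cases l using Fin.cases with
    | zero =>
      refine ⟨by simp [B], fun hu => ?_⟩
      have := congrArg Finset.card hu
      simp [B] at this
      exact hn this
    | succ l =>
      refine ⟨by simp [B], fun hu => (hA' l).2 ?_⟩
      have := congrArg Finset.card hu
      simp [B] at this
      exact (Finset.card_eq_iff_eq_univ _).1 (by simpa using this)

/-- The first d partial sums within `T` come from a chain, so they are a basis contained in the span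
of `T`. -/
theorem ChainIndependent.span_eq_top [FiniteDimensional ℝ V] {n d : ℕ} {x : Fin n → V}
    (h : ChainIndependent d x) (hd : Module.finrank ℝ V = d) {T : Finset (Fin n)}
    (hT : d ≤ T.card) (hT' : T ≠ Finset.univ) : Submodule.span ℝ (x '' T) = ⊤ := by
  let e := T.orderEmbOfFin rfl
  let A : Fin d → Finset (Fin n) := fun l =>
    (Finset.Iic (Fin.castLE hT l)).map e.toEmbedding
  have hAT : ∀ l, A l ⊆ T := by
    intro l k hk
    obtain ⟨m, -, rfl⟩ := Finset.mem_map.1 hk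
    exact T.orderEmbOfFin_mem rfl m
  have hA := h A (fun l m hlm => ?_) (fun l => ⟨by simp [A], fun hu => hT' ?_⟩)
  · rw [eq_top_iff, ← hA.span_eq_top_of_card_eq_finrank' (by simp [hd]), Submodule.span_le]
    rintro _ ⟨l, rfl⟩
    exact Submodule.sum_mem _ fun i hi => Submodule.subset_span ⟨i, hAT l hi, rfl⟩
  · simpa [A, Finset.map_ssubset_map, Finset.Iic_ssubset_Iic] using hlm
  · exact Finset.univ_subset_iff.1 (hu ▸ hAT l)

/-- Without indices 0 and j there remain n - 1 ≥ d vectors, which span. This supplies the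
perturbation off each wall. -/
theorem ChainIndependent.exists_relation [FiniteDimensional ℝ V] {n d : ℕ} {x : Fin (n + 1) → V}
    (h : ChainIndependent d x) (hd : Module.finrank ℝ V = d) (hn : d < n) (j : Fin n) :
    ∃ b : Fin n → ℝ, b j = 0 ∧ ∑ k, b k • Fin.tail x k = x 0 := by
  have hspan := h.span_eq_top hd (T := (Finset.univ.erase j).map (Fin.succEmb n))
    (by simp; omega) (fun hu => by
      have := Finset.mem_univ (0 : Fin (n + 1))
      simp [← hu] at this)
  have hmem : x 0 ∈ Submodule.span ℝ (Fin.tail x '' (Finset.univ.erase j : Finset (Fin n))) := by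
    have : Fin.tail x '' (Finset.univ.erase j : Finset (Fin n)) =
        x '' ((Finset.univ.erase j).map (Fin.succEmb n) : Finset (Fin (n + 1))) := by
      rw [Finset.coe_map, Set.image_image]; rfl
    rw [this, hspan]
    trivial
  obtain ⟨c, hc⟩ := (Submodule.mem_span_image_finset_iff_exists_fun' ℝ).1 hmem
  refine ⟨Function.update c j 0, by simp, ?_⟩
  rw [← hc, ← Finset.add_sum_erase _ _ (Finset.mem_univ j)]
  simp only [Function.update_self, zero_smul, zero_add]
  exact Finset.sum_congr rfl fun k hk => by rw [Function.update_of_ne (Finset.ne_of_mem_erase hk)]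

/-- Any `d` of the proper partial sums are linearly independent. -/
theorem ChainIndependent.linearIndepOn {m d : ℕ} {x : Fin (m + 1) → V}
    (h : ChainIndependent d x) {I : Finset (Fin m)} (hI : I.card = d) :
    LinearIndepOn ℝ (fun k : Fin m => ∑ i ∈ Finset.Iic k.castSucc, x i) I := by
  have := h (fun l => Finset.Iic (I.orderEmbOfFin hI l).castSucc)
    (fun l m hlm => by simpa [Finset.Iic_ssubset_Iic] using hlm)
    (fun l => ⟨by simp, fun hu => ?_⟩)
  · rw [LinearIndepOn, ← linearIndependent_equiv (I.orderIsoOfFin hI).toEquiv]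
    exact this
  · have := hu.symm ▸ Finset.mem_univ (Fin.last m)
    simp [Fin.le_def] at this
    have h2 := (I.orderEmbOfFin hI l).2
    omega

end GeneralPosition

/-! ### Increasing relations, positive relations and perturbation. -/

section Relations

variable {V : Type*} [AddCommGroup V] [Module ℝ V]

theorem sum_smul_sum_Iic {m : ℕ} (w : Fin m → ℝ) (x : Fin (m + 1) → V) :
    ∑ k, w k • ∑ i ∈ Finset.Iic k.castSucc, x i =
      ∑ i, (∑ k : Fin m, if i ≤ k.castSucc then w k else 0) • x i := by
  simp only [Finset.smul_sum, Finset.sum_smul]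
  rw [Finset.sum_comm]
  refine Finset.sum_congr rfl fun k _ => ?_
  have : Finset.Iic k.castSucc = Finset.univ.filter (· ≤ k.castSucc) := by ext; simp
  rw [this, Finset.sum_filter]
  exact Finset.sum_congr rfl fun i _ => by split_ifs <;> simp

theorem sum_ite_le_sub {m : ℕ} (a : Fin (m + 1) → ℝ) (i : Fin (m + 1)) :
    (∑ k : Fin m, if i ≤ k.castSucc then a k.succ - a k.castSucc else 0) = a (Fin.last m) - a i := by
  induction m with
  | zero => simp [Fin.fin_one_eq_zero i]
  | succ m ih =>
    cases i using Fin.lastCases with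
    | last =>
      rw [sub_self]
      exact Finset.sum_eq_zero fun k _ => if_neg (not_le.2 (Fin.castSucc_lt_last k))
    | cast i =>
      rw [Fin.sum_univ_castSucc]
      have := ih (fun k => a k.castSucc) i
      simp only [Fin.castSucc_le_castSucc_iff, Fin.succ_castSucc] at this ⊢
      rw [this, if_pos (Fin.le_last i), Fin.succ_last]
      ring

/-- Summation by parts: increasing relations between the `x i` are positive relations between
their partial sums. -/
theorem hasMonoRelation_iff_pos_relation {m : ℕ} {x : Fin (m + 1) → V} (hx : ∑ i, x i = 0) :
    HasMonoRelation x ↔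
      ∃ w : Fin m → ℝ, (∀ k, 0 < w k) ∧ ∑ k, w k • ∑ i ∈ Finset.Iic k.castSucc, x i = 0 := by
  constructor
  · rintro ⟨a, ha, hs⟩
    refine ⟨fun k => a k.succ - a k.castSucc, fun k => sub_pos.2 (ha Fin.castSucc_lt_succ), ?_⟩
    rw [sum_smul_sum_Iic]
    simp only [sum_ite_le_sub, sub_smul, Finset.sum_sub_distrib, ← Finset.smul_sum, hx, hs]
    simp
  · rintro ⟨w, hw, hs⟩
    rw [sum_smul_sum_Iic] at hs
    -- Negated tail sums of `w`: passing from i to i + 1 raises the coefficient by `w i`.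
    refine ⟨fun i => -∑ k : Fin m, if i ≤ k.castSucc then w k else 0, ?_, ?_⟩
    · refine Fin.strictMono_iff_lt_succ.2 fun i => neg_lt_neg (Finset.sum_lt_sum ?_ ⟨i, by simp, ?_⟩)
      · intro k _
        have := (hw k).le
        by_cases h : i.succ ≤ k.castSucc
        · simp [h, Fin.castSucc_lt_succ.le.trans h]
        · rw [if_neg h]; split_ifs <;> simp [this]
      · simp [hw i]
    · simp only [neg_smul, Finset.sum_neg_distrib, hs, neg_zero]

/-- For vectors in general position, a nontrivial nonnegative relation can be perturbed to a
positive one. -/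
theorem exists_pos_relation [FiniteDimensional ℝ V] {m d : ℕ} {T : Fin m → V}
    (hd : Module.finrank ℝ V = d) (hdm : d ≤ m)
    (hT : ∀ I : Finset (Fin m), I.card = d → LinearIndepOn ℝ T I)
    {w : Fin m → ℝ} (hw : ∀ k, 0 ≤ w k) (hw0 : w ≠ 0) (hs : ∑ k, w k • T k = 0) :
    ∃ u : Fin m → ℝ, (∀ k, 0 < u k) ∧ ∑ k, u k • T k = 0 := by
  classical
  set s := Finset.univ.filter fun k => w k ≠ 0 with hsdef
  -- A nonzero relation cannot be supported on fewer than d vectors, as any d are independent.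
  have hcard : d ≤ s.card := by
    by_contra! hlt
    obtain ⟨I, hsI, hI⟩ := Finset.exists_superset_card_eq hlt.le (by simpa using hdm)
    have hnot : ∀ k, k ∉ I → w k = 0 := fun k hk => by
      by_contra hne
      exact hk (hsI (by simp [hsdef, hne]))
    have hz := linearIndepOn_finset_iff.1 (hT I hI) w (by
      rw [← hs]
      exact Finset.sum_subset (Finset.subset_univ I) fun k _ hk => by simp [hnot k hk])
    exact hw0 (funext fun k => by
      by_cases hk : k ∈ I
      · exact hz k hk
      · exact hnot k hk)
  obtain ⟨I, hIs, hI⟩ := Finset.exists_subset_card_eq hcard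
  have hspan : Submodule.span ℝ (T '' I) = ⊤ := by
    have := (hT I hI).span_eq_top_of_card_eq_finrank' (by simp [hI, hd])
    rwa [Set.image_eq_range]
  obtain ⟨c, hc⟩ := (Submodule.mem_span_image_finset_iff_exists_fun' ℝ).1
    (hspan.symm ▸ Submodule.mem_top : -∑ k ∈ Finset.univ.filter (fun k => w k = 0), T k ∈
      Submodule.span ℝ (T '' I))
  -- A relation equal to 1 wherever `w` vanishes, balanced on a basis inside the support of `w`; a
  -- small multiple added to `w` makes every entry positive.
  let g : Fin m → ℝ := fun k => (if w k = 0 then 1 else 0) + if k ∈ I then c k else 0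
  have hg : ∑ k, g k • T k = 0 := by
    simp only [g, add_smul, Finset.sum_add_distrib, ite_smul, one_smul, zero_smul,
      Finset.sum_ite_mem, Finset.univ_inter, hc]
    rw [← Finset.sum_filter, add_neg_cancel]
  have hev : ∀ᶠ ε in nhdsWithin (0 : ℝ) (Set.Ioi 0), ∀ k, 0 < w k + ε * g k := by
    refine Filter.eventually_all.2 fun k => ?_
    rcases (hw k).eq_or_lt with hk | hk
    · filter_upwards [self_mem_nhdsWithin] with ε hε
      have hkI : k ∉ I := fun h => (Finset.mem_filter.1 (hIs h)).2 hk.symm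
      simpa [g, hkI, ← hk] using hε
    · have : ContinuousAt (fun ε : ℝ => w k + ε * g k) 0 := by fun_prop
      exact (continuousAt_const.eventually_lt this (by simpa using hk)).filter_mono
        nhdsWithin_le_nhds
  obtain ⟨ε, hε⟩ := hev.exists
  refine ⟨_, hε, ?_⟩
  simp only [add_smul, mul_smul, Finset.sum_add_distrib, ← Finset.smul_sum, hg, hs]
  simp

end Relations

/-! ### Parity sums and the recurrence for Stirling numbers. -/

section Stirling

/-- The even sum settles dimension 0; both parities are proved together because the Stirling
recurrence mixes them. -/
theorem two_mul_sum_stirlingFirst_parity {n : ℕ} (hn : 2 ≤ n) :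
    2 * ∑ j ∈ Finset.range n, Nat.stirlingFirst n (2 + 2 * j) = n.factorial ∧
      2 * ∑ j ∈ Finset.range n, Nat.stirlingFirst n (1 + 2 * j) = n.factorial := by
  induction n, hn using Nat.le_induction with
  | base => decide
  | succ n hn ih =>
    have h1 : ∀ j, Nat.stirlingFirst (n + 1) (2 + 2 * j) =
        n * Nat.stirlingFirst n (2 + 2 * j) + Nat.stirlingFirst n (1 + 2 * j) := fun j => by
      rw [show 2 + 2 * j = (1 + 2 * j) + 1 by ring, Nat.stirlingFirst_succ_succ]
    have h2 : ∀ j, Nat.stirlingFirst (n + 1) (1 + 2 * j) =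
        n * Nat.stirlingFirst n (1 + 2 * j) + Nat.stirlingFirst n (2 * j) := fun j => by
      rw [show 1 + 2 * j = 2 * j + 1 by ring, Nat.stirlingFirst_succ_succ]
    have hE : ∑ j ∈ Finset.range (n + 1), Nat.stirlingFirst n (2 + 2 * j) =
        ∑ j ∈ Finset.range n, Nat.stirlingFirst n (2 + 2 * j) := by
      rw [Finset.sum_range_succ, Nat.stirlingFirst_eq_zero_of_lt (by omega), add_zero]
    have hO : ∑ j ∈ Finset.range (n + 1), Nat.stirlingFirst n (1 + 2 * j) =
        ∑ j ∈ Finset.range n, Nat.stirlingFirst n (1 + 2 * j) := by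
      rw [Finset.sum_range_succ, Nat.stirlingFirst_eq_zero_of_lt (by omega), add_zero]
    have hE' : ∑ j ∈ Finset.range (n + 1), Nat.stirlingFirst n (2 * j) =
        ∑ j ∈ Finset.range n, Nat.stirlingFirst n (2 + 2 * j) := by
      rw [Finset.sum_range_succ']
      have : Nat.stirlingFirst n (2 * 0) = 0 := by
        obtain ⟨k, rfl⟩ := Nat.exists_eq_add_of_le' (show 1 ≤ n by omega)
        exact Nat.stirlingFirst_succ_zero k
      rw [this, add_zero]
      exact Finset.sum_congr rfl fun j _ => by congr 1; ring
    simp only [h1, h2, Finset.sum_add_distrib, ← Finset.mul_sum, hE, hO, hE', Nat.factorial_succ]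
    constructor
    · linear_combination n * ih.1 + ih.2
    · linear_combination n * ih.2 + ih.1

theorem sum_stirlingFirst_succ (n d : ℕ) :
    ∑ j ∈ Finset.range (n + 1), Nat.stirlingFirst (n + 1) (d + 1 + 2 + 2 * j) =
      n * ∑ j ∈ Finset.range n, Nat.stirlingFirst n (d + 1 + 2 + 2 * j) +
        ∑ j ∈ Finset.range n, Nat.stirlingFirst n (d + 2 + 2 * j) := by
  rw [Finset.sum_range_succ, Nat.stirlingFirst_eq_zero_of_lt (by omega), add_zero,
    Finset.mul_sum, ← Finset.sum_add_distrib]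
  refine Finset.sum_congr rfl fun j _ => ?_
  rw [show d + 1 + 2 + 2 * j = (d + 2 + 2 * j) + 1 by ring, Nat.stirlingFirst_succ_succ]

end Stirling

/-! ### The number of orderings with an increasing relation. -/

section Count

universe u

/-- Ensures that projecting along `x 0` lowers the dimension by exactly one. -/
theorem ChainIndependent.apply_zero_ne_zero {V : Type u} [AddCommGroup V] [Module ℝ V] {m d : ℕ}
    {x : Fin (m + 1) → V} (h : ChainIndependent d x) (hd : d ≠ 0) (hdm : d ≤ m) : x 0 ≠ 0 := by
  obtain ⟨m, rfl⟩ : ∃ k, m = k + 1 := Nat.exists_eq_succ_of_ne_zero (by omega)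
  obtain ⟨I, h0, hI⟩ := Finset.exists_superset_card_eq (s := {(0 : Fin (m + 1))}) (n := d)
    (by simp; omega) (by simpa using hdm)
  have := (h.linearIndepOn hI).ne_zero (show (0 : Fin (m + 1)) ∈ (I : Set _) by simpa using h0)
  have hIic : Finset.Iic ((0 : Fin (m + 1)).castSucc) = {0} := by
    ext k; simp
  simpa only [hIic, Finset.sum_singleton] using this

/-- `V` and `d` are quantified after `n` because the induction passes to quotients. In dimension 0
every ordering counts; for n = d + 1 > 1 all n - 1 partial sums are independent, so none does. -/
theorem monoRelationCount_eq (n : ℕ) (hn : 2 ≤ n) :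
    ∀ (V : Type u) [AddCommGroup V] [Module ℝ V] [FiniteDimensional ℝ V] (d : ℕ) (x : Fin n → V),
      Module.finrank ℝ V = d → d + 1 ≤ n → ChainIndependent d x → ∑ i, x i = 0 →
      monoRelationCount x = 2 * ∑ j ∈ Finset.range n, Nat.stirlingFirst n (d + 2 + 2 * j) := by
  have hzero : ∀ (n : ℕ), 2 ≤ n → ∀ (V : Type u) [AddCommGroup V] [Module ℝ V]
      [FiniteDimensional ℝ V] (x : Fin n → V), Module.finrank ℝ V = 0 →
      monoRelationCount x = 2 * ∑ j ∈ Finset.range n, Nat.stirlingFirst n (0 + 2 + 2 * j) := by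
    intro n hn V _ _ _ x hd
    classical
    have := Module.finrank_zero_iff.1 hd
    simp only [zero_add]
    rw [(two_mul_sum_stirlingFirst_parity hn).1, monoRelationCount, Nat.card_eq_fintype_card,
      Fintype.card_of_subtype Finset.univ]
    · simp [Fintype.card_perm]
    · intro σ
      simp only [Finset.mem_univ, true_iff]
      exact ⟨fun i => (i : ℕ), fun i j hij => by simpa using hij, Subsingleton.elim _ _⟩
  have htop : ∀ (m : ℕ), m ≠ 0 → ∀ (V : Type u) [AddCommGroup V] [Module ℝ V]
      [FiniteDimensional ℝ V] (x : Fin (m + 1) → V), ChainIndependent m x →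
      ∑ i, x i = 0 → monoRelationCount x =
        2 * ∑ j ∈ Finset.range (m + 1), Nat.stirlingFirst (m + 1) (m + 2 + 2 * j) := by
    intro m hm V _ _ _ x hx hs
    rw [Finset.sum_eq_zero fun j _ => Nat.stirlingFirst_eq_zero_of_lt (by omega), mul_zero,
      monoRelationCount, Nat.card_eq_zero]
    refine Or.inl ⟨fun ⟨σ, hσ⟩ => ?_⟩
    rw [hasMonoRelation_iff_pos_relation (by simpa using (Equiv.sum_comp σ x).trans hs)] at hσ
    obtain ⟨w, hw, hrel⟩ := hσ
    have hli := linearIndepOn_finset_iff.1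
      ((hx.comp_perm σ).linearIndepOn (I := Finset.univ) (by simp)) w hrel
    exact (hw ⟨0, Nat.pos_of_ne_zero hm⟩).ne' (hli _ (Finset.mem_univ _))
  induction n, hn using Nat.le_induction with
  | base =>
    intro V _ _ _ d x hd hdn hx hs
    rcases d with _ | d
    · exact hzero 2 le_rfl V x hd
    · obtain rfl : d = 0 := by omega
      exact htop 1 one_ne_zero V x hx hs
  | succ n hn ih =>
    intro V _ _ _ d x hd hdn hx hs
    rcases d with _ | d
    · exact hzero _ (by omega) V x hd
    · rcases (show d + 1 ≤ n by omega).eq_or_lt with rfl | hlt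
      · exact htop _ (by omega) V x hx hs
      · have hx0 := hx.apply_zero_ne_zero (by omega) hlt.le
        rw [monoRelationCount_succ x (hx.exists_relation hd hlt), sum_stirlingFirst_succ]
        have hsum : x 0 + ∑ i, Fin.tail x i = 0 := by rw [← hs, Fin.sum_univ_succ]; rfl
        have hquot : Module.finrank ℝ (V ⧸ Submodule.span ℝ {x 0}) = d := by
          have := Submodule.finrank_quotient_add_finrank (Submodule.span ℝ {x 0})
          rw [finrank_span_singleton hx0, hd] at this
          omega
        rw [ih _ d _ hquot (by omega) (hx.quotient (by omega)) (by
          rw [← map_sum, Submodule.mkQ_apply, Submodule.Quotient.mk_eq_zero,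
            ← neg_eq_of_add_eq_zero_right hsum]
          exact Submodule.neg_mem _ (Submodule.mem_span_singleton_self _))]
        rw [Finset.sum_congr rfl fun j _ => ih V (d + 1) _ hd hlt (hx.merge j) (by
          rw [Finset.sum_update_of_mem (Finset.mem_univ j), add_right_comm,
            Finset.sdiff_singleton_eq_erase, Finset.add_sum_erase _ _ (Finset.mem_univ j),
            add_comm, hsum])]
        simp only [Finset.sum_const, Finset.card_univ, Fintype.card_fin, smul_eq_mul]
        ring

end Count

/-! ### From partial sums and hulls to chains and relations. -/

section PartialSums

theorem Finset.eq_filter_val_lt_card_of_isLowerSet {n : ℕ} {S : Finset (Fin n)}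
    (hS : IsLowerSet (S : Set (Fin n))) : S = Finset.univ.filter fun i : Fin n => i.val < S.card := by
  ext i
  simp only [Finset.mem_filter, Finset.mem_univ, true_and]
  constructor
  · intro hi
    have : Finset.Iic i ⊆ S := fun k hk => hS (Finset.mem_Iic.1 hk) hi
    simpa [Nat.succ_le_iff] using Finset.card_le_card this
  · intro hi
    by_contra hiS
    have : S ⊆ Finset.Iio i := fun k hk => by
      rw [Finset.mem_Iio]
      by_contra! hle
      exact hiS (hS hle hk)
    have := Finset.card_le_card this
    simp at this
    omega

variable {V : Type*} [AddCommGroup V] [Module ℝ V]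

/-- Sorting indices by the level at which they enter a chain turns its sets into initial segments,
and its sums into partial sums of a reordering. -/
theorem chainIndependent_of_partialSum {n d : ℕ} {x : Fin n → V}
    (h : ∀ (σ : Equiv.Perm (Fin n)) (I : Finset ℕ), I ⊆ Finset.Icc 1 (n - 1) → I.card = d →
      LinearIndependent ℝ fun k : I =>
        ∑ i ∈ Finset.univ.filter (fun i : Fin n => i.val < k), x (σ i)) :
    ChainIndependent d x := by
  classical
  intro A hA hA'
  -- The first level whose set contains j, or d if there is none.
  let f : Fin n → ℕ := fun j => (Finset.univ.filter fun l => j ∉ A l).card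
  have hf : ∀ j l, j ∈ A l ↔ f j ≤ (l : ℕ) := by
    intro j l
    constructor
    · intro hj
      have : (Finset.univ.filter fun l => j ∉ A l) ⊆ Finset.Iio l := fun k hk => by
        rw [Finset.mem_Iio]
        by_contra! hle
        exact (Finset.mem_filter.1 hk).2 (hA.monotone hle hj)
      simpa using Finset.card_le_card this
    · intro hle
      by_contra hj
      have : Finset.Iic l ⊆ Finset.univ.filter fun l => j ∉ A l := fun k hk =>
        Finset.mem_filter.2 ⟨Finset.mem_univ _,
          fun hk' => hj (hA.monotone (Finset.mem_Iic.1 hk) hk')⟩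
      have := Finset.card_le_card this
      rw [Fin.card_Iic] at this
      exact absurd (this.trans hle) (by omega)
  set σ := Tuple.sort f
  have hσ : Monotone (f ∘ σ) := Tuple.monotone_sort f
  have hpre : ∀ l, (A l).map σ.symm.toEmbedding =
      Finset.univ.filter fun i : Fin n => i.val < (A l).card := by
    intro l
    have hmem : ∀ i, i ∈ (A l).map σ.symm.toEmbedding ↔ f (σ i) ≤ (l : ℕ) := fun i => by
      rw [← hf]; simp
    have := Finset.eq_filter_val_lt_card_of_isLowerSet (S := (A l).map σ.symm.toEmbedding)
      (fun i k hki hi => (hmem k).2 ((hσ hki).trans ((hmem i).1 hi)))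
    rwa [Finset.card_map] at this
  have hcard : StrictMono fun l => (A l).card := fun l m hlm => Finset.card_lt_card (hA hlm)
  have hI := h σ (Finset.univ.image fun l => (A l).card) ?_ ?_
  · have := hI.comp (fun l : Fin d => ⟨(A l).card, Finset.mem_image_of_mem _ (Finset.mem_univ l)⟩)
      (fun l m hlm => hcard.injective (congrArg Subtype.val hlm))
    convert this using 2 with l
    simp [← hpre]
  · intro c hc
    obtain ⟨l, -, rfl⟩ := Finset.mem_image.1 hc
    have h1 := Finset.card_pos.2 (hA' l).1
    have h2 := Finset.card_lt_univ_of_notMem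
      (not_forall.1 fun hu => (hA' l).2 (Finset.eq_univ_iff_forall.2 hu)).choose_spec
    simp only [Fintype.card_fin] at h2
    exact Finset.mem_Icc.2 ⟨h1, by omega⟩
  · rw [Finset.card_image_of_injective _ hcard.injective]
    simp

theorem filter_val_lt_succ_eq_Iic {m : ℕ} (k : Fin m) :
    (Finset.univ.filter fun i : Fin (m + 1) => i.val < k + 1) = Finset.Iic k.castSucc := by
  ext i
  simp [Fin.le_def]

theorem zero_mem_convexHull_partialSum_iff {m : ℕ} (x : Fin (m + 1) → V) :
    (0 : V) ∈ convexHull ℝ ((fun k : ℕ => ∑ i ∈ Finset.univ.filter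
        (fun i : Fin (m + 1) => i.val < k), x i) '' Set.Icc 1 m) ↔
      ∃ w ∈ stdSimplex ℝ (Fin m), ∑ k, w k • ∑ i ∈ Finset.Iic k.castSucc, x i = 0 := by
  classical
  set T : Fin m → V := fun k => ∑ i ∈ Finset.Iic k.castSucc, x i with hT
  have hrange : (fun k : ℕ => ∑ i ∈ Finset.univ.filter
      (fun i : Fin (m + 1) => i.val < k), x i) '' Set.Icc 1 m =
      Fintype.linearCombination ℝ T '' Set.range fun i : Fin m => Pi.single i (1 : ℝ) := by
    rw [← Set.range_comp]
    ext v
    constructor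
    · rintro ⟨k, ⟨hk1, hkm⟩, rfl⟩
      obtain ⟨k, rfl⟩ := Nat.exists_eq_add_of_le' hk1
      refine ⟨⟨k, hkm⟩, ?_⟩
      simp only [Function.comp_apply, Fintype.linearCombination_apply_single, one_smul, hT]
      rw [← filter_val_lt_succ_eq_Iic]
    · rintro ⟨k, rfl⟩
      refine ⟨k + 1, ⟨by omega, k.2⟩, ?_⟩
      simp only [Function.comp_apply, Fintype.linearCombination_apply_single, one_smul, hT]
      rw [← filter_val_lt_succ_eq_Iic]
  rw [hrange, ← LinearMap.image_convexHull, convexHull_rangle_single_eq_stdSimplex]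
  rfl

theorem ChainIndependent.zero_mem_convexHull_iff [FiniteDimensional ℝ V] {m d : ℕ}
    {x : Fin (m + 1) → V} (h : ChainIndependent d x) (hd : Module.finrank ℝ V = d) (hdm : d ≤ m)
    (hm : m ≠ 0) (hx : ∑ i, x i = 0) :
    (0 : V) ∈ convexHull ℝ ((fun k : ℕ => ∑ i ∈ Finset.univ.filter
        (fun i : Fin (m + 1) => i.val < k), x i) '' Set.Icc 1 m) ↔ HasMonoRelation x := by
  rw [zero_mem_convexHull_partialSum_iff, hasMonoRelation_iff_pos_relation hx]
  constructor
  · rintro ⟨w, ⟨hw, hw1⟩, hs⟩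
    refine exists_pos_relation hd hdm (fun I hI => h.linearIndepOn hI) hw ?_ hs
    rintro rfl
    simp at hw1
  · rintro ⟨w, hw, hs⟩
    have hpos : 0 < ∑ k, w k := Finset.sum_pos (fun k _ => hw k)
      ⟨⟨0, Nat.pos_of_ne_zero hm⟩, Finset.mem_univ _⟩
    refine ⟨fun k => (∑ l, w l)⁻¹ * w k, ⟨fun k => (mul_pos (inv_pos.2 hpos) (hw k)).le, ?_⟩, ?_⟩
    · rw [← Finset.mul_sum, inv_mul_cancel₀ hpos.ne']
    · simp only [mul_smul, ← Finset.smul_sum, hs, smul_zero]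

/-- The set is a projection of a closed set along the compact simplex of weights; closedness gives
the measurability needed to apply exchangeability. -/
theorem isClosed_zero_mem_convexHull_partialSum {E : Type*} [NormedAddCommGroup E]
    [NormedSpace ℝ E] (m : ℕ) :
    IsClosed {x : Fin (m + 1) → E | (0 : E) ∈ convexHull ℝ ((fun k : ℕ =>
      ∑ i ∈ Finset.univ.filter (fun i : Fin (m + 1) => i.val < k), x i) '' Set.Icc 1 m)} := by
  have hclosed : IsClosed {p : (Fin (m + 1) → E) × stdSimplex ℝ (Fin m) |
      ∑ k, p.2.1 k • ∑ i ∈ Finset.Iic k.castSucc, p.1 i = 0} :=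
    isClosed_eq (continuous_finsetSum _ fun k _ =>
      (((continuous_apply k).comp continuous_subtype_val).comp continuous_snd).smul
        (by fun_prop)) continuous_const
  convert isClosedMap_fst_of_compactSpace _ hclosed using 1
  ext x
  simp only [zero_mem_convexHull_partialSum_iff, Set.mem_ofPred_eq, Set.mem_image, Prod.exists,
    exists_and_right, exists_eq_right, Subtype.exists, exists_prop]

end PartialSums

/-! ### Averaging over orderings. -/

theorem theorem2p1 {Ω : Type*} [MeasurableSpace Ω] (P : Measure Ω) [IsProbabilityMeasure P]
    (d n : ℕ) (hn : d + 1 ≤ n)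
    (ξ : Fin n → Ω → EuclideanSpace ℝ (Fin d))
    (hmeas : ∀ i, Measurable (ξ i))
    (hexch : Exchangeable ξ P)
    (hbridge : ∀ᵐ ω ∂P, partialSum ξ n ω = 0)
    (hindep : ∀ I : Finset ℕ, I ⊆ Finset.Icc 1 (n - 1) → I.card = d →
      ∀ᵐ ω ∂P, LinearIndependent ℝ (fun k : I => partialSum ξ k ω)) :
    P.real {ω | (0 : EuclideanSpace ℝ (Fin d)) ∈
        convexHull ℝ ((fun k => partialSum ξ k ω) '' Set.Icc 1 (n - 1))} =
      2 / (n.factorial : ℝ) *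
        ∑ j ∈ Finset.range n, (Nat.stirlingFirst n (d + 2 + 2 * j) : ℝ) := by
  classical
  obtain ⟨m, rfl⟩ : ∃ m, n = m + 1 := Nat.exists_eq_add_of_le' (by omega)
  -- For n = 1 the hull is empty and the Stirling sum vanishes.
  rcases Nat.eq_zero_or_pos m with rfl | hm
  · obtain rfl : d = 0 := by omega
    simp [Nat.stirlingFirst_eq_zero_of_lt]
  set M : Set (Fin (m + 1) → EuclideanSpace ℝ (Fin d)) :=
    {x | (0 : EuclideanSpace ℝ (Fin d)) ∈ convexHull ℝ ((fun k : ℕ =>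
      ∑ i ∈ Finset.univ.filter (fun i : Fin (m + 1) => i.val < k), x i) '' Set.Icc 1 m)}
  have hMmeas : MeasurableSet M := (isClosed_zero_mem_convexHull_partialSum m).measurableSet
  have hperm : ∀ᵐ ω ∂P, ∀ (σ : Equiv.Perm (Fin (m + 1))) (I : Finset ℕ),
      I ⊆ Finset.Icc 1 (m + 1 - 1) → I.card = d → LinearIndependent ℝ fun k : I =>
        ∑ i ∈ Finset.univ.filter (fun i : Fin (m + 1) => i.val < k), ξ (σ i) ω := by
    simp only [ae_all_iff]
    intro σ I hI hId
    -- Independence is an open, hence measurable, condition, so it transfers to every reordering.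
    refine (hexch σ).ae_snd (p := fun x => LinearIndependent ℝ fun k : I =>
      ∑ i ∈ Finset.univ.filter (fun i : Fin (m + 1) => i.val < k), x i) ?_ (hindep I hI hId)
    have hcont : Continuous fun (x : Fin (m + 1) → EuclideanSpace ℝ (Fin d)) (k : I) =>
        ∑ i ∈ Finset.univ.filter (fun i : Fin (m + 1) => i.val < k), x i := by fun_prop
    exact (isOpen_setOfPred_linearIndependent.preimage hcont).measurableSet
  have hcount : ∀ᵐ ω ∂P, ∑ σ : Equiv.Perm (Fin (m + 1)),
      ((fun ω i => ξ (σ i) ω) ⁻¹' M).indicator (1 : Ω → ℝ) ω =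
        2 * ∑ j ∈ Finset.range (m + 1), (Nat.stirlingFirst (m + 1) (d + 2 + 2 * j) : ℝ) := by
    filter_upwards [hperm, hbridge] with ω hω hsum
    set x : Fin (m + 1) → EuclideanSpace ℝ (Fin d) := fun i => ξ i ω with hx
    have hchain : ChainIndependent d x := chainIndependent_of_partialSum hω
    have hsum' : ∑ i, x i = 0 := by
      rw [← hsum, partialSum, Finset.filter_true_of_mem fun i _ => i.2]
    have := monoRelationCount_eq (m + 1) (by omega) _ d x (by simp) hn hchain hsum'
    rw [monoRelationCount, Nat.card_eq_fintype_card, Fintype.card_subtype,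
      Finset.card_filter] at this
    have hcast := congrArg (Nat.cast (R := ℝ)) this
    push_cast at hcast
    rw [← hcast]
    refine Finset.sum_congr rfl fun σ _ => ?_
    have hiff := (hchain.comp_perm σ).zero_mem_convexHull_iff (by simp) (by omega) hm.ne'
      ((Equiv.sum_comp σ x).trans hsum')
    rw [Set.indicator_apply, if_congr (show ω ∈ (fun ω i => ξ (σ i) ω) ⁻¹' M ↔ _ from hiff) rfl rfl]
    split_ifs <;> simp
  have hprob : ∀ σ : Equiv.Perm (Fin (m + 1)),
      P.real ((fun ω i => ξ (σ i) ω) ⁻¹' M) = P.real ((fun ω i => ξ i ω) ⁻¹' M) := fun σ => by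
    rw [measureReal_def, measureReal_def, (hexch σ).measure_mem_eq hMmeas]
  have hpre : ∀ σ : Equiv.Perm (Fin (m + 1)), MeasurableSet ((fun ω i => ξ (σ i) ω) ⁻¹' M) :=
    fun σ => measurable_pi_lambda _ (fun i => hmeas (σ i)) hMmeas
  have hint := integral_congr_ae hcount
  rw [integral_const, probReal_univ, one_smul, integral_finsetSum _ fun σ _ =>
    (integrable_const (1 : ℝ)).indicator (hpre σ) (f := 1)] at hint
  simp only [fun σ => integral_indicator_one (μ := P) (hpre σ), hprob, Finset.sum_const,
    Finset.card_univ, Fintype.card_perm, Fintype.card_fin, nsmul_eq_mul] at hint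
  have hfac : ((m + 1).factorial : ℝ) ≠ 0 := Nat.cast_ne_zero.2 (Nat.factorial_ne_zero _)
  change P.real ((fun ω i => ξ i ω) ⁻¹' M) = _
  rw [div_mul_eq_mul_div, ← hint, mul_div_cancel_left₀ _ hfac]
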